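/- Let $\Gamma$ be the first Grigorchuk group, i.e. the group of automorphisms of the infinite rooted binary tree with vertex set $\{0,1\}^*$ generated by the automorphisms $a,b,c,d$ with $$a(0w)=1w,\ a(1w)=0w,\quad b(0w)=0a(w),\ b(1w)=1c(w),\quad c(0w)=0a(w),\ c(1w)=1d(w),\quad d(0w)=0w,\ d(1w)=1b(w).$$ A word over $\{a,b,c,d\}$ is *reduced* if of any two consecutive letters exactly one is $a$; every element of $\Gamma$ is represented by a reduced word. The reduced form of a word is obtained by applying $a^2=b^2=c^2=d^2=1$, $bc=cb=d$, $bd=db=c$, $cd=dc=b$; $|w|$ is the length of a word $w$. Let $K$ be the normal closure of $abab$ in $\Gamma$, and for $u,v\in\Gamma$ put $Q(u,v)=\{xK \mid x\in\Gamma,\ u=x^{-1}vx\}\subseteq\Gamma/K$, so that $u$ and $v$ are conjugate if and only if $Q(u,v)\neq\emptyset$. For reduced words $u,v$ and $g\in Q(u,v)$ let $$L(u,v,g)=\min\{|x| \ :\ x \text{ a reduced word},\ u=x^{-1}vx \text{ in } \Gamma,\ xK=g\}.$$ The *splitting tree* $T(w)$ of a reduced word $w$ is the rooted tree of reduced words with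 root $w$ defined recursively as follows. If $|w|\le 1$, then $T(w)$ is a single vertex. If $|w|\geq 2$ and $w$ has an even number of letters $a$, so that $w=(w_0,w_1)$ fixes the first level of the tree, the children of the root are the roots of $T(w_0)$ and $T(w_1)$. If $|w|\ge 2$ and $w$ has an odd number of letters $a$, so that $w=(w_0,w_1)a$, the only child of the root is the root of $T(w')$, where $w'$ is the reduced form of $w_0w_1$. Here $w_0,w_1$ are the reduced forms of the words that are obtained letter by letter from $w$ (respectively $wa$) by the rules $b=(a,c)$, $c=(a,d)$, $d=(1,b)$, $aba=(c,a)$, $aca=(d,a)$, $ada=(b,1)$. Let $h(u,v)$ be the maximum of the heights of $T(u)$ and $T(v)$. **Proposition.** There is a constant $C$ such that for all reduced words $u,v$, not both empty: 1. for every $g\in Q(u,v)$ we have $L(u,v,g)\le C\,(|u|+|v|)^8$; that is, if $u$ and $v$ are conjugate in $\Gamma$, then every coset of $K$ that contains some $x$ with $u=x^{-1}vx$ contains such an $x$ that is represented by a reduced word of length at most $C(|u|+|v|)^8$; 2. the trees $T(u)$ and $T(v)$ have finite height and $h(u,v)\le\log_{1.22}(|u|+|v|)+C$. -/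

import Mathlib

namespace Grigorchuk

/-- The alphabet `X = {a, b, c, d}`. -/
inductive Letter
  | a | b | c | d
  deriving DecidableEq

/-- Words over `X`; the length `|w|` is `w.length`. -/
abbrev Word := List Letter

/-- The action of the four letters on the vertices of the rooted binary tree, i.e. on finite
words in `0 = false` and `1 = true`. -/
def Letter.act : Letter → List Bool → List Bool
  | _, [] => []
  | .a, x :: w => (!x) :: w
  | .b, false :: w => false :: Letter.act .a w
  | .b, true :: w => true :: Letter.act .c w
  | .c, false :: w => false :: Letter.act .a w
  | .c, true :: w => true :: Letter.act .d w
  | .d, false :: w => false :: w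
  | .d, true :: w => true :: Letter.act .b w

theorem Letter.act_act (x : Letter) (w : List Bool) : x.act (x.act w) = w := by
  induction w generalizing x with
  | nil => cases x <;> rfl
  | cons i w ih => cases x <;> cases i <;> simp [Letter.act, ih]

/-- The vertices joined by an edge `w → w0` or `w → w1` of the tree. -/
def IsEdge (v w : List Bool) : Prop := ∃ i : Bool, w = v ++ [i]

/-- The letters act by automorphisms of the rooted binary tree. -/
theorem Letter.act_isEdge (x : Letter) {v w : List Bool} (h : IsEdge v w) :
    IsEdge (x.act v) (x.act w) := by
  obtain ⟨i, rfl⟩ := h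
  induction v generalizing x with
  | nil => cases x <;> cases i <;> simp [Letter.act, IsEdge]
  | cons j v ih =>
    simp only [IsEdge] at ih ⊢
    cases x <;> cases j <;> simp only [List.cons_append, Letter.act, List.cons.injEq, true_and]
    all_goals first | exact ih _ | exact ⟨i, rfl⟩

/-- The automorphism of the tree given by a letter, as a permutation of the vertices. -/
def Letter.perm (x : Letter) : Equiv.Perm (List Bool) :=
  Function.Involutive.toPerm x.act x.act_act

/-- The first Grigorchuk group `Γ`, generated by the automorphisms `a, b, c, d` of the rooted
binary tree (the product is composition of maps). -/
def Gam : Subgroup (Equiv.Perm (List Bool)) :=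
  Subgroup.closure (Set.range Letter.perm)

/-- The generator of `Γ` given by a letter. -/
def gen (x : Letter) : Gam :=
  ⟨x.perm, Subgroup.subset_closure (Set.mem_range_self x)⟩

/-- The element of `Γ` represented by a word. -/
def eval (w : Word) : Gam := (w.map gen).prod

/-- Reduced words `[a] *₁ a *₂ a ⋯ a *ₖ [a]` with `*ᵢ ∈ {b, c, d}`: of any two consecutive
letters, exactly one is `a`. -/
def IsReduced (w : Word) : Prop :=
  w.IsChain (fun x y => x = .a ↔ y ≠ .a)

/-- `K`, the normal closure of `abab` in `Γ`. -/
def K : Subgroup Gam := Subgroup.normalClosure {eval [.a, .b, .a, .b]}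

/-- `Q(u, v) = {xK | u = x⁻¹ v x} ⊆ Γ / K`. -/
def Q (u v : Gam) : Set (Gam ⧸ K) :=
  {g | ∃ x : Gam, u = x⁻¹ * v * x ∧ (x : Gam ⧸ K) = g}

/-- The lengths `|x|` of the reduced words `x` such that `u = x⁻¹ v x` and `xK = g`; the number
`L(u, v, g)` is the least element of this set. -/
def conjugatorLengths (u v : Word) (g : Gam ⧸ K) : Set ℕ :=
  {n | ∃ x : Word, IsReduced x ∧ eval u = (eval x)⁻¹ * eval v * eval x ∧
    (eval x : Gam ⧸ K) = g ∧ x.length = n}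

/-! ### The splitting tree -/

/-- The product of two distinct letters of `{b, c, d}`, which is the third one
(the value on other pairs is not used). -/
def third : Letter → Letter → Letter
  | .b, .c => .d
  | .c, .b => .d
  | .b, .d => .c
  | .d, .b => .c
  | _, _ => .b

/-- Multiply a reduced word by a letter on the left and reduce, by means of
`a² = b² = c² = d² = 1`, `bc = cb = d`, `bd = db = c`, `cd = dc = b`. -/
def push (x : Letter) : Word → Word
  | [] => [x]
  | y :: w => if x = y then w else if x = .a ∨ y = .a then x :: y :: w else third x y :: w

/-- The reduced form `red(w)` of a word. -/
def red (w : Word) : Word := w.foldr push []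

/-- The two coordinates (`false` for the left one and `true` for the right one) of `ψ(b) = (a, c)`,
`ψ(c) = (a, d)`, `ψ(d) = (1, b)`; the value at the letter `a` is not used. -/
def letterSection : Bool → Letter → Word
  | _, .a => []
  | false, .b => [.a]
  | false, .c => [.a]
  | false, .d => []
  | true, .b => [.c]
  | true, .c => [.d]
  | true, .d => [.b]

/-- For a word `w` with an even number of `a`'s, `wordSection false w` and `wordSection true w` are
the words `φ₀(w)` and `φ₁(w)`: every letter `a` exchanges the two coordinates of the letters that
come after it. When the number of `a`'s is odd, they are `φ₀(wa)` and `φ₁(wa)`. -/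
def wordSection : Bool → Word → Word
  | _, [] => []
  | i, .a :: w => wordSection (!i) w
  | i, x :: w => letterSection i x ++ wordSection i w

/-- The labels of the children of a vertex labelled `w` of a splitting tree: none if `|w| ≤ 1`,
otherwise `w₀` and `w₁` if `w = (w₀, w₁)` lies in the stabilizer of the first level, and the
reduced form of `w₀ w₁` if `w = (w₀, w₁) a` does not. -/
def children (w : Word) : List Word :=
  if w.length ≤ 1 then []
  else if Even (w.count .a) then [red (wordSection false w), red (wordSection true w)]
  else [red (red (wordSection false w) ++ red (wordSection true w))]

/-- The splitting tree `T(w)` has height at most `n`: every path that descends from its root has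
at most `n` edges. -/
def HeightLE : ℕ → Word → Prop
  | 0, w => children w = []
  | n + 1, w => ∀ w' ∈ children w, HeightLE n w'

/-- `IsHeight u v h` says that `h = h(u, v)`, the maximum of the heights of `T(u)` and `T(v)`. -/
def IsHeight (u v : Word) (h : ℕ) : Prop :=
  IsLeast {n : ℕ | HeightLE n u ∧ HeightLE n v} h

end Grigorchuk

namespace Grigorchuk

/-! Both bounds come from a contraction. For the letter weights 13, 14, 9, 5 of `a, b, c, d`, the
two sections of a reduced word together weigh at most 1/1.22 of the word plus a constant
(`IsReduced.weight_sections`). Every child in the splitting tree obeys this bound, so the height is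
logarithmic to base 1.22.

For conjugators, write x = (p, q), after replacing x by xa if necessary. Then u = x⁻¹vx turns into
equations for p and q between sections, and induction replaces p and q by short words y₀, y₁ in the
same cosets of `K`. Since K × K ≤ K (`exists_mem_K_isPair`), the pair (y₀, y₁) belongs to Γ, and to
xK; by `exists_word_of_isPair` it has a word of length 2(|y₀| + |y₁|) + O(1). Hence a bound M at
total weight m yields 4M + 2m + O(1) at weight about 1.22m (`exists_conjBound_step`). Because (6/5)⁸
> 4, this recursion solves to O(n⁸). It starts from finitely many triples (u, v, g), as Γ/K is
finite. -/

instance : Fintype Letter := ⟨{.a, .b, .c, .d}, fun x => by cases x <;> decide⟩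

instance : K.Normal := Subgroup.normalClosure_normal

/-! ### Words and the elements they represent -/

@[simp] theorem eval_nil : eval [] = 1 := rfl

@[simp] theorem eval_cons (x : Letter) (w : Word) : eval (x :: w) = gen x * eval w := by
  simp [eval]

@[simp] theorem eval_append (v w : Word) : eval (v ++ w) = eval v * eval w := by
  simp [eval]

@[simp] theorem coe_gen_apply (x : Letter) (t : List Bool) :
    (gen x : Equiv.Perm (List Bool)) t = x.act t := rfl

@[simp] theorem gen_mul_self (x : Letter) : gen x * gen x = 1 := by
  ext1; ext1 t
  exact x.act_act t

@[simp] theorem gen_mul_gen_mul (x : Letter) (g : Gam) : gen x * (gen x * g) = g := by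
  rw [← mul_assoc, gen_mul_self, one_mul]

@[simp] theorem gen_inv (x : Letter) : (gen x)⁻¹ = gen x :=
  inv_eq_of_mul_eq_one_left (gen_mul_self x)

theorem eval_reverse (w : Word) : eval w.reverse = (eval w)⁻¹ := by
  induction w with
  | nil => simp
  | cons x w ih => simp [ih]

theorem exists_eval_eq (g : Gam) : ∃ w, eval w = g := by
  obtain ⟨g, hg⟩ := g
  induction hg using Subgroup.closure_induction with
  | mem x hx =>
    obtain ⟨y, rfl⟩ := hx
    exact ⟨[y], by simp [gen]⟩
  | one => exact ⟨[], rfl⟩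
  | mul x y hx hy h₁ h₂ =>
    obtain ⟨v, hv⟩ := h₁
    obtain ⟨w, hw⟩ := h₂
    exact ⟨v ++ w, by rw [eval_append, hv, hw]; rfl⟩
  | inv x hx h =>
    obtain ⟨v, hv⟩ := h
    exact ⟨v.reverse, by rw [eval_reverse, hv]; rfl⟩

theorem act_third (t : List Bool) :
    (Letter.act .b (Letter.act .c t) = Letter.act .d t ∧
      Letter.act .c (Letter.act .b t) = Letter.act .d t) ∧
    (Letter.act .c (Letter.act .d t) = Letter.act .b t ∧
      Letter.act .d (Letter.act .c t) = Letter.act .b t) ∧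
    (Letter.act .b (Letter.act .d t) = Letter.act .c t ∧
      Letter.act .d (Letter.act .b t) = Letter.act .c t) := by
  induction t with
  | nil => simp [Letter.act]
  | cons i t ih =>
    obtain ⟨⟨h1, h2⟩, ⟨h3, h4⟩, h5, h6⟩ := ih
    cases i <;> simp [Letter.act, Letter.act_act, h1, h2, h3, h4, h5, h6]

theorem gen_mul_gen {x y : Letter} (h : x ≠ y) (hx : x ≠ .a) (hy : y ≠ .a) :
    gen x * gen y = gen (third x y) := by
  ext1; ext1 t
  have := act_third t
  change x.act (y.act t) = (third x y).act t
  cases x <;> cases y <;> simp_all [third]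

theorem eval_push (x : Letter) (w : Word) : eval (push x w) = gen x * eval w := by
  cases w with
  | nil => simp [push]
  | cons y w =>
    rw [push]
    split_ifs with h₁ h₂
    · subst h₁; simp
    · simp
    · push Not at h₂
      rw [eval_cons, eval_cons, ← gen_mul_gen h₁ h₂.1 h₂.2, mul_assoc]

theorem eval_red (w : Word) : eval (red w) = eval w := by
  induction w with
  | nil => rfl
  | cons x w ih => rw [eval_cons, ← ih, ← eval_push]; rfl

theorem third_ne_a (x y : Letter) : third x y ≠ .a := by
  cases x <;> cases y <;> simp [third]

theorem IsReduced.push {w : Word} (hw : IsReduced w) (x : Letter) :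
    IsReduced (Grigorchuk.push x w) := by
  cases w with
  | nil => simp [Grigorchuk.push, IsReduced]
  | cons y w =>
    unfold IsReduced at *
    rw [Grigorchuk.push]
    split_ifs with h₁ h₂
    · exact hw.tail
    · rw [List.isChain_cons_cons]
      refine ⟨?_, hw⟩
      grind
    · cases w with
      | nil => simp
      | cons z w =>
        rw [List.isChain_cons_cons] at hw ⊢
        have := third_ne_a x y
        refine ⟨?_, hw.2⟩
        grind

theorem isReduced_red (w : Word) : IsReduced (red w) := by
  induction w with
  | nil => simp [red, IsReduced]
  | cons x w ih => exact ih.push x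

theorem length_push_le (x : Letter) (w : Word) : (push x w).length ≤ w.length + 1 := by
  cases w with
  | nil => simp [push]
  | cons y w =>
    rw [push]
    split_ifs
    all_goals simp
    omega

theorem length_red_le (w : Word) : (red w).length ≤ w.length := by
  induction w with
  | nil => simp [red]
  | cons x w ih => exact (length_push_le x (red w)).trans (by simpa using ih)

/-! ### Weights of words -/

/-- Weights of the letters for which the splitting of reduced words is contracting. -/
def Letter.weight : Letter → ℕ
  | .a => 13
  | .b => 14
  | .c => 9
  | .d => 5

/-- The weight of a word. -/
def weight (w : Word) : ℕ := (w.map Letter.weight).sum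

@[simp] theorem weight_nil : weight [] = 0 := rfl

@[simp] theorem weight_cons (x : Letter) (w : Word) : weight (x :: w) = x.weight + weight w := by
  simp [weight]

@[simp] theorem weight_append (v w : Word) : weight (v ++ w) = weight v + weight w := by
  simp [weight]

theorem length_le_weight (w : Word) : w.length ≤ weight w := by
  induction w with
  | nil => simp
  | cons x w ih => cases x <;> simp [Letter.weight] <;> omega

theorem weight_le (w : Word) : weight w ≤ 14 * w.length := by
  induction w with
  | nil => simp
  | cons x w ih => cases x <;> simp [Letter.weight] <;> omega

/-- The weights of `b, c, d` satisfy the triangle inequalities (14 = 9 + 5), so merging two letters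
never adds weight. -/
theorem weight_push_le (x : Letter) (w : Word) : weight (push x w) ≤ x.weight + weight w := by
  cases w with
  | nil => simp [push]
  | cons y w =>
    rw [push]
    split_ifs with h₁ h₂
    · simp; omega
    · simp
    · revert h₁ h₂
      cases x <;> cases y <;> simp [third, Letter.weight] <;> omega

theorem weight_red_le (w : Word) : weight (red w) ≤ weight w := by
  induction w with
  | nil => simp [red]
  | cons x w ih =>
    have := weight_push_le x (red w)
    rw [weight_cons]
    change weight (push x (red w)) ≤ _
    omega

theorem IsReduced.tail {x : Letter} {w : Word} (h : IsReduced (x :: w)) : IsReduced w :=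
  List.IsChain.tail h

/-- The pairs `ab, ac, ad` weigh 27, 22, 18 and their sections 22, 18, 14, each ratio being at most
50/61. A first letter other than `a` lacks its partner, which costs 650 = 50 · 13. -/
theorem IsReduced.weight_sections_aux {w : Word} (hw : IsReduced w) :
    61 * (weight (wordSection false w) + weight (wordSection true w)) ≤
      50 * weight w + if w = [] ∨ w.head? = some .a then 0 else 650 := by
  induction w with
  | nil => simp [wordSection]
  | cons x w ih =>
    have h := ih hw.tail
    cases x with
    | a =>
      have : 61 * (weight (wordSection false w) + weight (wordSection true w)) ≤
          50 * weight w + 650 := h.trans (by split_ifs <;> omega)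
      simp [wordSection, Letter.weight]
      omega
    | _ =>
      have h' : w = [] ∨ w.head? = some .a := by
        cases w with
        | nil => simp
        | cons y w =>
          have := (List.isChain_cons_cons.1 hw).1
          cases y <;> simp at this ⊢
      rw [if_pos h'] at h
      simp [wordSection, letterSection, Letter.weight]
      omega

theorem IsReduced.weight_sections {w : Word} (hw : IsReduced w) :
    61 * (weight (wordSection false w) + weight (wordSection true w)) ≤
      50 * weight w + 650 :=
  hw.weight_sections_aux.trans (by split_ifs <;> omega)

/-- A pair `a*` weighs at least 18, that is 9 per letter; an unpaired `d` falls short by 4. -/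
theorem IsReduced.length_le_weight_aux {w : Word} (hw : IsReduced w) :
    9 * w.length ≤ weight w + if w = [] ∨ w.head? = some .a then 0 else 4 := by
  induction w with
  | nil => simp
  | cons x w ih =>
    have h := ih hw.tail
    cases x with
    | a =>
      have : 9 * w.length ≤ weight w + 4 := h.trans (by split_ifs <;> omega)
      simp [Letter.weight]
      omega
    | _ =>
      have h' : w = [] ∨ w.head? = some .a := by
        cases w with
        | nil => simp
        | cons y w =>
          have := (List.isChain_cons_cons.1 hw).1
          cases y <;> simp at this ⊢
      rw [if_pos h'] at h
      simp [Letter.weight]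
      omega

theorem IsReduced.length_le_weight {w : Word} (hw : IsReduced w) :
    9 * w.length ≤ weight w + 4 :=
  hw.length_le_weight_aux.trans (by split_ifs <;> omega)

/-! ### Heights of splitting trees -/

theorem HeightLE.succ {n : ℕ} {w : Word} (h : HeightLE n w) : HeightLE (n + 1) w := by
  induction n generalizing w with
  | zero =>
    intro w' hw'
    have h' : children w = [] := h
    simp [h'] at hw'
  | succ n ih => exact fun w' hw' => ih (h w' hw')

theorem HeightLE.mono {m n : ℕ} {w : Word} (h : HeightLE m w) (hmn : m ≤ n) : HeightLE n w := by
  induction hmn with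
  | refl => exact h
  | step _ ih => exact ih.succ

/-- A decision procedure for `HeightLE`. -/
def heightLE : ℕ → Word → Bool
  | 0, w => (children w).isEmpty
  | n + 1, w => (children w).all (heightLE n)

theorem heightLE_of_eq_true {n : ℕ} {w : Word} (h : heightLE n w = true) : HeightLE n w := by
  induction n generalizing w with
  | zero => exact List.isEmpty_iff.1 h
  | succ n ih =>
    intro w' hw'
    rw [heightLE, List.all_eq_true] at h
    exact ih (h w' hw')

/-- The reduced words of length at most `n` in which the first letter is `a` (`i = true`) or is not
`a` (`i = false`). -/
def reducedWords : ℕ → Bool → List Word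
  | 0, _ => [[]]
  | n + 1, true => [] :: (reducedWords n false).map (.a :: ·)
  | n + 1, false => [] :: (reducedWords n true).flatMap fun w => [.b :: w, .c :: w, .d :: w]

theorem IsReduced.mem_reducedWords {w : Word} (hw : IsReduced w) {n : ℕ} (hn : w.length ≤ n)
    {i : Bool} (hi : ∀ x ∈ w.head?, x = .a ↔ i = true) : w ∈ reducedWords n i := by
  induction w generalizing n i with
  | nil => cases n <;> cases i <;> simp [reducedWords]
  | cons x w ih =>
    cases n with
    | zero => simp at hn
    | succ n =>
      have hw' : w ∈ reducedWords n (!i) := by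
        refine ih hw.tail (by simpa using hn) fun y hy => ?_
        cases w with
        | nil => simp at hy
        | cons z w =>
          have := (List.isChain_cons_cons.1 hw).1
          cases i <;> simp_all
      cases i <;> cases x <;> simp_all [reducedWords]

theorem heightLE_reducedWords (i : Bool) : ∀ w ∈ reducedWords 7 i, heightLE 4 w = true := by
  cases i <;> decide +kernel

theorem IsReduced.heightLE_of_length_le {w : Word} (hw : IsReduced w) (h : w.length ≤ 7) :
    HeightLE 4 w := by
  refine heightLE_of_eq_true (heightLE_reducedWords (w.head? = some .a) w ?_)
  refine hw.mem_reducedWords h fun x hx => ?_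
  simp_all

theorem isReduced_and_weight_of_mem_children {w w' : Word} (hw : IsReduced w)
    (h : w' ∈ children w) : IsReduced w' ∧ 61 * weight w' ≤ 50 * weight w + 650 := by
  have hs := hw.weight_sections
  have h₀ := weight_red_le (wordSection false w)
  have h₁ := weight_red_le (wordSection true w)
  rw [children] at h
  split_ifs at h
  · simp at h
  · simp only [List.mem_cons, List.not_mem_nil, or_false] at h
    rcases h with rfl | rfl <;> exact ⟨isReduced_red _, by omega⟩
  · simp only [List.mem_cons, List.not_mem_nil, or_false] at h
    subst h
    refine ⟨isReduced_red _, ?_⟩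
    have h₂ := weight_red_le (red (wordSection false w) ++ red (wordSection true w))
    rw [weight_append] at h₂
    omega

/-- The map W ↦ (50W + 650)/61 has fixed point 650/11, so the bound on 11W − 650 shrinks by the
factor 1.22 at each level. At k = 0 the weight is at most 60 and the length at most 7, which is the
range of the finite check. -/
theorem IsReduced.heightLE_of_weight_le {k : ℕ} {w : Word} (hw : IsReduced w)
    (h : 11 * (weight w : ℝ) ≤ 650 + 10 * 1.22 ^ k) : HeightLE (k + 4) w := by
  induction k generalizing w with
  | zero =>
    have h' : 11 * weight w ≤ 660 := by
      have : 11 * (weight w : ℝ) ≤ 660 := by norm_num at h; exact h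
      exact_mod_cast this
    have := hw.length_le_weight
    simpa using hw.heightLE_of_length_le (by omega)
  | succ k ih =>
    rw [show k + 1 + 4 = (k + 4) + 1 by ring]
    intro w' hw'
    obtain ⟨hr, hle⟩ := isReduced_and_weight_of_mem_children hw hw'
    refine ih hr ?_
    have hle' : 61 * (weight w' : ℝ) ≤ 50 * weight w + 650 := by exact_mod_cast hle
    rw [pow_succ] at h
    norm_num at h ⊢
    linarith

theorem IsReduced.exists_heightLE {w : Word} (hw : IsReduced w) {n : ℕ} (hn : 1 ≤ n)
    (hwn : w.length ≤ n) :
    HeightLE (⌈Real.logb 1.22 n + Real.logb 1.22 154⌉₊ + 4) w := by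
  apply hw.heightLE_of_weight_le
  set k := ⌈Real.logb 1.22 n + Real.logb 1.22 154⌉₊
  have hn' : (1 : ℝ) ≤ n := by exact_mod_cast hn
  -- 154 = 11 · 14, where 14 is the largest letter weight.
  have h₁ : Real.logb 1.22 (n * 154) ≤ k := by
    rw [Real.logb_mul (by positivity) (by norm_num)]
    exact Nat.le_ceil _
  rw [Real.logb_le_iff_le_rpow (by norm_num) (by positivity), Real.rpow_natCast] at h₁
  have h₂ : (weight w : ℝ) ≤ 14 * n := by
    exact_mod_cast (weight_le w).trans (by omega)
  nlinarith

theorem exists_isHeight {u v : Word} (hu : IsReduced u) (hv : IsReduced v)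
    (h : 0 < u.length + v.length) :
    ∃ n : ℕ, IsHeight u v n ∧ (n : ℝ) ≤
      Real.logb 1.22 ((u.length : ℝ) + v.length) + (Real.logb 1.22 154 + 5) := by
  classical
  have hex : ∃ n, HeightLE n u ∧ HeightLE n v :=
    ⟨_, hu.exists_heightLE h (by omega), hv.exists_heightLE h (by omega)⟩
  refine ⟨Nat.find hex, ⟨Nat.find_spec hex, fun n hn => Nat.find_min' hex hn⟩, ?_⟩
  have h₁ := Nat.find_min' hex
    ⟨hu.exists_heightLE h (by omega), hv.exists_heightLE h (by omega)⟩
  have h₂ : (1 : ℝ) ≤ (u.length : ℝ) + v.length := by exact_mod_cast h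
  have h₃ : 0 ≤ Real.logb 1.22 ((u.length : ℝ) + v.length) + Real.logb 1.22 154 :=
    add_nonneg (Real.logb_nonneg (by norm_num) h₂) (Real.logb_nonneg (by norm_num) (by norm_num))
  have h₄ := Nat.ceil_lt_add_one h₃
  have h₅ : (Nat.find hex : ℝ) ≤
      (⌈Real.logb 1.22 ((u.length + v.length : ℕ) : ℝ) + Real.logb 1.22 154⌉₊ + 4 : ℕ) := by
    exact_mod_cast h₁
  push_cast at h₅
  linarith

/-! ### Elements that fix the first level -/

/-- `IsPair g p q` says that `g` fixes the first level of the tree and acts on the two subtrees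
below it as `p` and `q`, i.e. `g = (p, q)`. -/
structure IsPair (g p q : Gam) : Prop where
  nil : (g : Equiv.Perm (List Bool)) [] = []
  left : ∀ t, (g : Equiv.Perm (List Bool)) (false :: t) =
    false :: (p : Equiv.Perm (List Bool)) t
  right : ∀ t, (g : Equiv.Perm (List Bool)) (true :: t) = true :: (q : Equiv.Perm (List Bool)) t

namespace IsPair

variable {g h p q r s : Gam}

theorem one : IsPair 1 1 1 := ⟨rfl, fun _ => rfl, fun _ => rfl⟩

theorem mul (hg : IsPair g p q) (hh : IsPair h r s) : IsPair (g * h) (p * r) (q * s) :=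
  ⟨by simp [hg.nil, hh.nil], fun t => by simp [hg.left, hh.left],
    fun t => by simp [hg.right, hh.right]⟩

theorem inv (hg : IsPair g p q) : IsPair g⁻¹ p⁻¹ q⁻¹ := by
  refine ⟨?_, fun t => ?_, fun t => ?_⟩ <;> rw [Subgroup.coe_inv, Equiv.Perm.inv_eq_iff_eq]
  · exact hg.nil.symm
  · simp [hg.left]
  · simp [hg.right]

theorem eq (hg : IsPair g p q) (hh : IsPair h p q) : g = h := by
  ext1; ext1 t
  rcases t with _ | ⟨i, t⟩
  · rw [hg.nil, hh.nil]
  · cases i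
    · rw [hg.left, hh.left]
    · rw [hg.right, hh.right]

theorem eq_left (hg : IsPair g p q) (hg' : IsPair g r s) : p = r := by
  ext1; ext1 t
  simpa [hg.left] using hg'.left t

theorem eq_right (hg : IsPair g p q) (hg' : IsPair g r s) : q = s := by
  ext1; ext1 t
  simpa [hg.right] using hg'.right t

theorem swap (hg : IsPair g p q) : IsPair (gen .a * g * gen .a) q p :=
  ⟨by simp [Letter.act, hg.nil], fun t => by simp [Letter.act, hg.right],
    fun t => by simp [Letter.act, hg.left]⟩

theorem not_mul_gen (hg : IsPair g p q) : ¬ IsPair (g * gen .a) r s := fun h => by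
  have := h.left []
  simp [Letter.act, hg.right] at this

end IsPair

theorem isPair_b : IsPair (gen .b) (gen .a) (gen .c) := ⟨rfl, fun _ => rfl, fun _ => rfl⟩

theorem isPair_c : IsPair (gen .c) (gen .a) (gen .d) := ⟨rfl, fun _ => rfl, fun _ => rfl⟩

theorem isPair_d : IsPair (gen .d) 1 (gen .b) := ⟨rfl, fun _ => rfl, fun _ => rfl⟩

theorem isPair_gen {x : Letter} (hx : x ≠ .a) :
    IsPair (gen x) (eval (letterSection false x)) (eval (letterSection true x)) := by
  cases x with
  | a => exact absurd rfl hx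
  | b => simpa [letterSection] using isPair_b
  | c => simpa [letterSection] using isPair_c
  | d => simpa [letterSection] using isPair_d

theorem isPair_eval_aux (w : Word) :
    (Even (w.count .a) →
      IsPair (eval w) (eval (wordSection false w)) (eval (wordSection true w))) ∧
    (¬ Even (w.count .a) →
      IsPair (eval w * gen .a) (eval (wordSection false w)) (eval (wordSection true w))) := by
  induction w with
  | nil => exact ⟨fun _ => IsPair.one, fun h => absurd (by simp) h⟩
  | cons x w ih =>
    by_cases hx : x = .a
    · subst hx
      simp only [List.count_cons_self, Nat.even_add_one, not_not, eval_cons, wordSection,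
        Bool.not_false, Bool.not_true]
      refine ⟨fun h => ?_, fun h => (ih.1 h).swap⟩
      have := (ih.2 h).swap
      rwa [mul_assoc, mul_assoc, gen_mul_self, mul_one] at this
    · have hc : (x :: w).count .a = w.count .a := by simp [hx]
      have hs (i : Bool) : wordSection i (x :: w) = letterSection i x ++ wordSection i w := by
        cases x <;> simp_all [wordSection]
      rw [hc, hs, hs, eval_cons, eval_append, eval_append, mul_assoc]
      exact ⟨fun h => (isPair_gen hx).mul (ih.1 h), fun h => (isPair_gen hx).mul (ih.2 h)⟩

theorem isPair_eval {w : Word} (h : Even (w.count .a)) :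
    IsPair (eval w) (eval (wordSection false w)) (eval (wordSection true w)) :=
  (isPair_eval_aux w).1 h

theorem isPair_eval_mul_gen {w : Word} (h : ¬ Even (w.count .a)) :
    IsPair (eval w * gen .a) (eval (wordSection false w)) (eval (wordSection true w)) :=
  (isPair_eval_aux w).2 h

theorem exists_isPair_or (g : Gam) : (∃ p q, IsPair g p q) ∨ ∃ p q, IsPair (g * gen .a) p q := by
  obtain ⟨w, rfl⟩ := exists_eval_eq g
  by_cases h : Even (w.count .a)
  · exact .inl ⟨_, _, isPair_eval h⟩
  · exact .inr ⟨_, _, isPair_eval_mul_gen h⟩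

/-! ### The dihedral group generated by `a` and `d` -/

/-- `(ad)⁴ = 1`. -/
theorem adad_eq : gen .a * gen .d * gen .a * gen .d = gen .d * gen .a * gen .d * gen .a := by
  -- `ada = (b, 1)` and `d = (1, b)` move disjoint subtrees, hence commute.
  have h₁ := isPair_d.swap.mul isPair_d
  have h₂ := isPair_d.mul isPair_d.swap
  rw [mul_one, one_mul] at h₁ h₂
  simpa only [mul_assoc] using h₁.eq h₂

/-- The elements of the subgroup generated by `a` and `d`. -/
def dihedral : Set Gam :=
  eval '' {[], [.a], [.d], [.a, .d], [.d, .a], [.a, .d, .a], [.d, .a, .d], [.a, .d, .a, .d]}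

theorem finite_dihedral : dihedral.Finite := Set.Finite.image _ (Set.toFinite _)

theorem one_mem_dihedral : 1 ∈ dihedral := ⟨[], by simp, rfl⟩

theorem gen_mul_mem_dihedral {x : Letter} (hx : x = .a ∨ x = .d) {g : Gam} (hg : g ∈ dihedral) :
    gen x * g ∈ dihedral := by
  have h := adad_eq
  simp only [mul_assoc] at h
  have h' : gen .d * (gen .a * (gen .d * (gen .a * gen .d))) =
      gen .a * (gen .d * gen .a) := by rw [h]; simp
  simp only [dihedral, Set.image_insert_eq, Set.image_singleton, Set.mem_insert_iff,
    Set.mem_singleton_iff, eval_cons, eval_nil, mul_one] at hg ⊢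
  rcases hx with rfl | rfl <;> rcases hg with rfl | rfl | rfl | rfl | rfl | rfl | rfl | rfl <;>
    simp [h.symm, h']

/-! ### The quotient by `K` -/

theorem commute_a_b : Commute (gen .a : Gam ⧸ K) (gen .b) := by
  have h : gen .a * gen .b * gen .a * gen .b ∈ K :=
    Subgroup.subset_normalClosure (by simp [mul_assoc])
  rw [← QuotientGroup.eq_one_iff] at h
  have h₂ : ((gen .a * gen .b : Gam) : Gam ⧸ K) = ((gen .a * gen .b)⁻¹ : Gam) := by
    rw [QuotientGroup.mk_inv, eq_inv_iff_mul_eq_one, ← QuotientGroup.mk_mul, ← h]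
    simp [mul_assoc]
  simpa [Commute, SemiconjBy] using h₂

theorem gen_b_mul_gen_d : gen .b * gen .d = gen .c :=
  gen_mul_gen (by decide) (by decide) (by decide)

theorem gen_d_mul_gen_b : gen .d * gen .b = gen .c :=
  gen_mul_gen (by decide) (by decide) (by decide)

theorem commute_d_b : Commute (gen .d : Gam ⧸ K) (gen .b) := by
  rw [Commute, SemiconjBy, ← QuotientGroup.mk_mul, ← QuotientGroup.mk_mul, gen_b_mul_gen_d,
    gen_d_mul_gen_b]

/-- Modulo `K` the generator `b` commutes with `a` and `d`, and c = bd, so every coset meets {1, b}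
· ⟨a, d⟩. -/
instance : Finite (Gam ⧸ K) := by
  have hfin : (Set.image2 (fun x y : Gam => ((x * y : Gam) : Gam ⧸ K)) {1, gen .b}
      dihedral).Finite := Set.Finite.image2 _ (Set.toFinite _) finite_dihedral
  refine Set.finite_univ_iff.1 (hfin.subset ?_)
  rintro g -
  obtain ⟨g, rfl⟩ := QuotientGroup.mk_surjective g
  obtain ⟨w, rfl⟩ := exists_eval_eq g
  have hb {g : Gam} (hg : (g : Gam ⧸ K) ∈ Set.image2 (fun x y : Gam => ((x * y : Gam) : Gam ⧸ K))
      {1, gen .b} dihedral) : ((gen .b * g : Gam) : Gam ⧸ K) ∈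
        Set.image2 (fun x y : Gam => ((x * y : Gam) : Gam ⧸ K)) {1, gen .b} dihedral := by
    obtain ⟨x, hx, y, hy, h⟩ := hg
    refine ⟨gen .b * x, ?_, y, hy, ?_⟩
    · rcases hx with rfl | rfl <;> simp
    · simp only [mul_assoc, QuotientGroup.mk_mul] at h ⊢
      rw [h]
  have had {x : Letter} (hx : x = .a ∨ x = .d) {g : Gam}
      (hg : (g : Gam ⧸ K) ∈ Set.image2 (fun x y : Gam => ((x * y : Gam) : Gam ⧸ K))
      {1, gen .b} dihedral) : ((gen x * g : Gam) : Gam ⧸ K) ∈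
        Set.image2 (fun x y : Gam => ((x * y : Gam) : Gam ⧸ K)) {1, gen .b} dihedral := by
    have hc : Commute (gen x : Gam ⧸ K) (gen .b) := by
      rcases hx with rfl | rfl
      exacts [commute_a_b, commute_d_b]
    obtain ⟨y, hy, z, hz, h⟩ := hg
    refine ⟨y, hy, gen x * z, gen_mul_mem_dihedral hx hz, ?_⟩
    simp only [QuotientGroup.mk_mul] at h ⊢
    rw [← h]
    rcases hy with rfl | rfl
    · simp
    · rw [← mul_assoc, ← hc.eq, mul_assoc]
  induction w with
  | nil => exact ⟨1, by simp, 1, one_mem_dihedral, by simp⟩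
  | cons x w ih =>
    rw [eval_cons]
    cases x with
    | a => exact had (.inl rfl) ih
    | b => exact hb ih
    | c => rw [← gen_b_mul_gen_d, mul_assoc]; exact hb (had (.inr rfl) ih)
    | d => exact had (.inr rfl) ih

/-! ### Lifting pairs to words -/

/-- A substitution on words with `(w, f(w))` represented by `lift w`. -/
def liftWord : Word → Word
  | [] => []
  | .a :: w => .c :: liftWord w
  | .b :: w => [.a, .d, .a] ++ liftWord w
  | .c :: w => [.a, .b, .a] ++ liftWord w
  | .d :: w => [.a, .c, .a] ++ liftWord w

/-- The letters lift by c = (a, d), ada = (b, 1), aba = (c, a), aca = (d, a). All right coordinates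
lie in the finite group ⟨a, d⟩, so the lift prescribes the left coordinate with a bounded error on
the right. -/
theorem exists_isPair_liftWord (w : Word) :
    ∃ z ∈ dihedral, IsPair (eval (liftWord w)) (eval w) z := by
  induction w with
  | nil => exact ⟨1, one_mem_dihedral, IsPair.one⟩
  | cons x w ih =>
    obtain ⟨z, hz, h⟩ := ih
    cases x with
    | a => exact ⟨_, gen_mul_mem_dihedral (.inr rfl) hz, by simpa [liftWord] using isPair_c.mul h⟩
    | b => exact ⟨z, hz, by simpa [liftWord, mul_assoc] using isPair_d.swap.mul h⟩
    | c => exact ⟨_, gen_mul_mem_dihedral (.inl rfl) hz,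
        by simpa [liftWord, mul_assoc] using isPair_b.swap.mul h⟩
    | d => exact ⟨_, gen_mul_mem_dihedral (.inl rfl) hz,
        by simpa [liftWord, mul_assoc] using isPair_c.swap.mul h⟩

theorem IsReduced.length_liftWord_aux {w : Word} (hw : IsReduced w) :
    (liftWord w).length ≤ 2 * w.length + if w = [] ∨ w.head? = some .a then 0 else 1 := by
  induction w with
  | nil => simp [liftWord]
  | cons x w ih =>
    have h := ih hw.tail
    cases x with
    | a =>
      have : (liftWord w).length ≤ 2 * w.length + 1 := h.trans (by split_ifs <;> omega)
      simp [liftWord]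
      omega
    | _ =>
      have h' : w = [] ∨ w.head? = some .a := by
        cases w with
        | nil => simp
        | cons y w =>
          have := (List.isChain_cons_cons.1 hw).1
          cases y <;> simp at this ⊢
      rw [if_pos h'] at h
      simp [liftWord]
      omega

theorem IsReduced.length_liftWord {w : Word} (hw : IsReduced w) :
    (liftWord w).length ≤ 2 * w.length + 1 :=
  hw.length_liftWord_aux.trans (by split_ifs <;> omega)

-- Only finitely many pairs occur, so a constant exists without being computed.
open Filter in
theorem exists_word_of_mem_dihedral : ∃ C : ℕ, ∀ p ∈ dihedral, ∀ q ∈ dihedral, ∀ g : Gam,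
    IsPair g p q → ∃ w, eval w = g ∧ w.length ≤ C := by
  suffices h : ∀ᶠ C : ℕ in atTop, ∀ p ∈ dihedral, ∀ q ∈ dihedral, ∀ g : Gam,
      IsPair g p q → ∃ w, eval w = g ∧ w.length ≤ C from h.exists
  refine (eventually_all_finite finite_dihedral).2 fun p _ => ?_
  refine (eventually_all_finite finite_dihedral).2 fun q _ => ?_
  by_cases hg : ∃ g, IsPair g p q
  · obtain ⟨g, hg⟩ := hg
    obtain ⟨w, rfl⟩ := exists_eval_eq g
    filter_upwards [eventually_ge_atTop w.length] with C hC g' hg'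
    exact ⟨w, hg.eq hg', hC⟩
  · exact .of_forall fun C g' hg' => absurd ⟨g', hg'⟩ hg

/-- Lifting y₀ on the left and, conjugated by `a`, y₁ on the right gives (y₀, z) and (z', y₁).
Cancelling both from g leaves (z'⁻¹, z⁻¹), with z and z' in ⟨a, d⟩, which has a word of bounded
length. -/
theorem exists_word_of_isPair : ∃ C : ℕ, ∀ (g : Gam) (y₀ y₁ : Word),
    IsPair g (eval y₀) (eval y₁) →
      ∃ y, eval y = g ∧ y.length ≤ 2 * (y₀.length + y₁.length) + C := by
  obtain ⟨C, hC⟩ := exists_word_of_mem_dihedral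
  refine ⟨C + 4, fun g y₀ y₁ hg => ?_⟩
  obtain ⟨z, hz, h₀⟩ := exists_isPair_liftWord (red y₀)
  obtain ⟨z', hz', h₁⟩ := exists_isPair_liftWord (red y₁)
  rw [eval_red] at h₀ h₁
  have hk := (h₀.inv.mul hg).mul h₁.swap.inv
  rw [inv_mul_cancel, one_mul, mul_inv_cancel_right] at hk
  obtain ⟨w, hw, hwC⟩ := hC z' hz' z hz _ (by simpa using hk.inv)
  refine ⟨liftWord (red y₀) ++ w.reverse ++ ([.a] ++ liftWord (red y₁) ++ [.a]), ?_, ?_⟩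
  · simp only [eval_append, eval_reverse, hw, eval_cons, eval_nil, mul_one]
    group
  · have h₂ := (isReduced_red y₀).length_liftWord
    have h₃ := (isReduced_red y₁).length_liftWord
    have h₄ := length_red_le y₀
    have h₅ := length_red_le y₁
    simp only [List.length_append, List.length_reverse, List.length_cons, List.length_nil]
    omega

/-! ### `K × K` is contained in `K` -/

theorem exists_mem_K_isPair_one {k : Gam} (hk : k ∈ K) : ∃ g ∈ K, IsPair g k 1 := by
  induction hk using Subgroup.closure_induction with
  | mem x hx =>
    obtain ⟨_, rfl, hx⟩ := Group.mem_conjugatesOfSet_iff.1 hx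
    obtain ⟨y, rfl⟩ := isConj_iff.1 hx
    obtain ⟨w, rfl⟩ := exists_eval_eq y
    obtain ⟨z, -, hz⟩ := exists_isPair_liftWord w
    -- b · ada = (ab, c) has square (abab, 1). The square is in `K` because `b` and `ada` are
    -- involutions that commute modulo `K`. Conjugating by a lift of y gives (y abab y⁻¹, 1).
    have h₁ := isPair_b.mul isPair_d.swap
    have h₂ := h₁.mul h₁
    have h₃ := (hz.mul h₂).mul hz.inv
    have hc : Commute (gen .b : Gam ⧸ K) (gen .a * gen .d * gen .a : Gam) := by
      rw [QuotientGroup.mk_mul, QuotientGroup.mk_mul]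
      exact ((commute_a_b.mul_left commute_d_b).mul_left commute_a_b).symm
    have hK : gen .b * (gen .a * gen .d * gen .a) * (gen .b * (gen .a * gen .d * gen .a)) ∈ K := by
      rw [← QuotientGroup.eq_one_iff, QuotientGroup.mk_mul, QuotientGroup.mk_mul]
      nth_rw 1 [hc.eq]
      rw [mul_assoc, ← mul_assoc (gen .b : Gam ⧸ K), ← QuotientGroup.mk_mul,
        gen_mul_self, QuotientGroup.mk_one, one_mul, ← QuotientGroup.mk_mul]
      simp [mul_assoc]
    exact ⟨_, Subgroup.Normal.conj_mem (inferInstance : K.Normal) _ hK (eval (liftWord w)),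
      by simpa [mul_assoc] using h₃⟩
  | one => exact ⟨1, K.one_mem, IsPair.one⟩
  | mul x y _ _ hx hy =>
    obtain ⟨g, hg, hx⟩ := hx
    obtain ⟨h, hh, hy⟩ := hy
    exact ⟨_, K.mul_mem hg hh, by simpa using hx.mul hy⟩
  | inv x _ hx =>
    obtain ⟨g, hg, hx⟩ := hx
    exact ⟨_, K.inv_mem hg, by simpa using hx.inv⟩

theorem exists_mem_K_isPair {k l : Gam} (hk : k ∈ K) (hl : l ∈ K) : ∃ g ∈ K, IsPair g k l := by
  obtain ⟨g, hg, h₁⟩ := exists_mem_K_isPair_one hk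
  obtain ⟨h, hh, h₂⟩ := exists_mem_K_isPair_one hl
  have hh' := Subgroup.Normal.conj_mem (inferInstance : K.Normal) _ hh (gen .a)
  rw [gen_inv] at hh'
  exact ⟨_, K.mul_mem hg hh', by simpa using h₁.mul h₂.swap⟩

/-! ### Short conjugators -/

/-- The coset `xK` contains an element that conjugates `v` to `u` and is represented by a word of
length at most `M`. -/
def HasConjugator (u v x : Gam) (M : ℕ) : Prop :=
  ∃ y : Word, u = (eval y)⁻¹ * v * eval y ∧ x⁻¹ * eval y ∈ K ∧ y.length ≤ M

theorem HasConjugator.mono {u v x : Gam} {M N : ℕ} (h : HasConjugator u v x M) (hMN : M ≤ N) :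
    HasConjugator u v x N :=
  h.imp fun _ hy => ⟨hy.1, hy.2.1, hy.2.2.trans hMN⟩

theorem HasConjugator.of_conj_a {u v x : Gam} {M : ℕ}
    (h : HasConjugator (gen .a * u * gen .a) v (x * gen .a) M) :
    HasConjugator u v x (M + 1) := by
  obtain ⟨y, h₁, h₂, h₃⟩ := h
  refine ⟨y ++ [.a], ?_, ?_, by simpa using h₃⟩
  · have : u = gen .a * (gen .a * u * gen .a) * gen .a := by simp [mul_assoc]
    rw [this, h₁]
    simp [mul_assoc]
  · have := Subgroup.Normal.conj_mem (inferInstance : K.Normal) _ h₂ (gen .a)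
    simpa [mul_assoc] using this

/-- `ConjBound n M` says that all conjugators between words of total weight at most `n` may be
replaced by words of length at most `M` in the same coset of `K`. -/
def ConjBound (n M : ℕ) : Prop :=
  ∀ u v : Word, weight u + weight v ≤ n → ∀ x : Gam, eval u = x⁻¹ * eval v * x →
    HasConjugator (eval u) (eval v) x M

theorem exists_mul_mem_K {x p q y₀ y₁ : Gam} (hx : IsPair x p q) (h₀ : p⁻¹ * y₀ ∈ K)
    (h₁ : q⁻¹ * y₁ ∈ K) : ∃ k ∈ K, IsPair (x * k) y₀ y₁ := by
  obtain ⟨k, hk, h⟩ := exists_mem_K_isPair h₀ h₁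
  exact ⟨k, hk, by simpa using hx.mul h⟩

theorem exists_hasConjugator_of_isPair : ∃ C : ℕ, ∀ {m M : ℕ} {u v x p q : Gam}
    {u₀ u₁ v₀ v₁ : Word}, ConjBound m M → IsPair x p q →
    weight u₀ + weight u₁ + weight v₀ + weight v₁ ≤ m → u = x⁻¹ * v * x →
    (IsPair u (eval u₀) (eval u₁) ∧ IsPair v (eval v₀) (eval v₁) ∨
      IsPair (u * gen .a) (eval u₀) (eval u₁) ∧ IsPair (v * gen .a) (eval v₀) (eval v₁)) →
    HasConjugator u v x (4 * M + 2 * m + C) := by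
  obtain ⟨C, hC⟩ := exists_word_of_isPair
  refine ⟨C, fun {m M u v x p q u₀ u₁ v₀ v₁} hB hx hw huv h => ?_⟩
  rcases h with ⟨hu, hv⟩ | ⟨hu, hv⟩
  · have h' := (hx.inv.mul hv).mul hx
    rw [← huv] at h'
    obtain ⟨y₀, h₀, hk₀, hl₀⟩ := hB u₀ v₀ (by omega) p (hu.eq_left h')
    obtain ⟨y₁, h₁, hk₁, hl₁⟩ := hB u₁ v₁ (by omega) q (hu.eq_right h')
    obtain ⟨k, hk, hxk⟩ := exists_mul_mem_K hx hk₀ hk₁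
    obtain ⟨y, hy, hyC⟩ := hC _ _ _ hxk
    refine ⟨y, ?_, by simpa [hy] using hk, by omega⟩
    rw [← hy] at hxk
    refine hu.eq ?_
    rw [h₀, h₁]
    exact (hxk.inv.mul hv).mul hxk
  -- For u = (u₀, u₁)a and v = (v₀, v₁)a the equations are u₀ = p⁻¹v₀q and u₁ = q⁻¹v₁p. Thus p
  -- conjugates v₀v₁ to u₀u₁ and determines q = v₀⁻¹pu₀.
  · have conj_eq (z : Gam) : z⁻¹ * v * z * gen .a =
        z⁻¹ * (v * gen .a) * (gen .a * z * gen .a) := by simp [mul_assoc]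
    have h' := (hx.inv.mul hv).mul hx.swap
    rw [← conj_eq, ← huv] at h'
    have hp := hu.eq_left h'
    have hq := hu.eq_right h'
    obtain ⟨y₀, h₀, hk₀, hl₀⟩ := hB (u₀ ++ u₁) (v₀ ++ v₁) (by simp; omega) p
      (by rw [eval_append, eval_append, hp, hq]; group)
    rw [eval_append, eval_append] at h₀
    -- The second coordinate is forced to be v₀⁻¹y₀u₀; its extra letters u₀, v₀ number at most m,
    -- hence the term 2m.
    have hk₁ : q⁻¹ * eval (v₀.reverse ++ y₀ ++ u₀) ∈ K := by
      have := Subgroup.Normal.conj_mem (inferInstance : K.Normal) _ hk₀ (eval u₀)⁻¹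
      have hq' : q⁻¹ = (eval u₀)⁻¹ * p⁻¹ * eval v₀ := by rw [hp]; group
      rw [hq', eval_append, eval_append, eval_reverse]
      simpa [mul_assoc] using this
    obtain ⟨k, hk, hxk⟩ := exists_mul_mem_K hx hk₀ hk₁
    obtain ⟨y, hy, hyC⟩ := hC _ _ _ hxk
    refine ⟨y, ?_, by simpa [hy] using hk, ?_⟩
    · rw [← hy] at hxk
      have hxk' := (hxk.inv.mul hv).mul hxk.swap
      rw [← conj_eq] at hxk'
      refine mul_right_cancel (hu.eq ?_)
      convert hxk' using 1
      · rw [eval_append, eval_append, eval_reverse]; group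
      · have : eval u₁ = (eval u₀)⁻¹ * (eval u₀ * eval u₁) := by group
        rw [this, h₀, eval_append, eval_append, eval_reverse]
        group
    · have := length_le_weight u₀
      have := length_le_weight v₀
      simp only [List.length_append, List.length_reverse] at hyC
      omega

/-- The parity records whether the element fixes the first level, which is invariant under
conjugation. -/
theorem even_count_iff_of_isPair {u v : Word} {x p q : Gam} (hx : IsPair x p q)
    (h : eval u = x⁻¹ * eval v * x) : Even (u.count .a) ↔ Even (v.count .a) := by
  constructor <;> intro h₁ <;> by_contra h₂
  · have h₃ := (hx.mul (isPair_eval h₁)).mul hx.inv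
    rw [h] at h₃
    rw [show x * (x⁻¹ * eval v * x) * x⁻¹ = eval v by group] at h₃
    exact h₃.not_mul_gen (isPair_eval_mul_gen h₂)
  · have h₃ := (hx.inv.mul (isPair_eval h₁)).mul hx
    rw [← h] at h₃
    exact h₃.not_mul_gen (isPair_eval_mul_gen h₂)

theorem exists_conjBound_step : ∃ C : ℕ, ∀ m n M : ℕ, 50 * n + 1300 < 61 * (m + 1) →
    ConjBound m M → ConjBound n (4 * M + 2 * m + C) := by
  obtain ⟨C, hC⟩ := exists_hasConjugator_of_isPair
  refine ⟨C + 1, fun m n M hmn hB u v huv x hx => ?_⟩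
  -- `ConjBound` ranges over all words, since sections and their products need not be reduced; the
  -- contraction needs reduced ones.
  wlog hr : IsReduced u ∧ IsReduced v generalizing u v
  · have h₁ := weight_red_le u
    have h₂ := weight_red_le v
    have := this (red u) (red v) (by omega) (by simpa [eval_red] using hx)
      ⟨isReduced_red u, isReduced_red v⟩
    simpa [eval_red] using this
  have hu := hr.1.weight_sections
  have hv := hr.2.weight_sections
  rcases exists_isPair_or x with ⟨p, q, hp⟩ | ⟨p, q, hp⟩
  · refine (hC hB hp (u₀ := wordSection false u) (u₁ := wordSection true u)
      (v₀ := wordSection false v) (v₁ := wordSection true v) (by omega) hx ?_).mono (by omega)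
    have hc := even_count_iff_of_isPair hp hx
    by_cases he : Even (u.count .a)
    · exact .inl ⟨isPair_eval he, isPair_eval (hc.1 he)⟩
    · exact .inr ⟨isPair_eval_mul_gen he, isPair_eval_mul_gen (mt hc.2 he)⟩
  -- Passing from x to xa conjugates u by `a`, which swaps its sections and costs one letter.
  · have hx' : gen .a * eval u * gen .a = (x * gen .a)⁻¹ * eval v * (x * gen .a) := by
      rw [hx]; simp [mul_assoc]
    refine HasConjugator.of_conj_a ?_
    refine (hC hB hp (u₀ := wordSection true u) (u₁ := wordSection false u)
      (v₀ := wordSection false v) (v₁ := wordSection true v) (by omega) hx' ?_).mono le_rfl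
    have hc : Even (u.count .a) ↔ Even (v.count .a) := by
      have := even_count_iff_of_isPair (u := [.a] ++ u ++ [.a]) (v := v) hp
        (by simpa [mul_assoc] using hx')
      simpa [Nat.even_add_one, List.count_append, parity_simps] using this
    by_cases he : Even (u.count .a)
    · exact .inl ⟨(isPair_eval he).swap, isPair_eval (hc.1 he)⟩
    · refine .inr ⟨?_, isPair_eval_mul_gen (mt hc.2 he)⟩
      simpa [mul_assoc] using (isPair_eval_mul_gen he).swap

open Filter in
theorem exists_conjBound (n : ℕ) : ∃ M, ConjBound n M := by
  have hfin : {w : Word | w.length ≤ n}.Finite := List.finite_length_le _ _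
  suffices h : ∀ᶠ M : ℕ in atTop, ∀ u ∈ {w : Word | w.length ≤ n},
      ∀ v ∈ {w : Word | w.length ≤ n}, ∀ g : Gam ⧸ K, ∀ x : Gam, (x : Gam ⧸ K) = g →
        eval u = x⁻¹ * eval v * x → HasConjugator (eval u) (eval v) x M by
    refine h.exists.imp fun M hM u v huv x hx => ?_
    have := length_le_weight u
    have := length_le_weight v
    exact hM u (show u.length ≤ n by omega) v (show v.length ≤ n by omega) _ x rfl hx
  refine (eventually_all_finite hfin).2 fun u _ => ?_
  refine (eventually_all_finite hfin).2 fun v _ => ?_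
  refine eventually_all.2 fun g => ?_
  by_cases hg : ∃ y : Gam, (y : Gam ⧸ K) = g ∧ eval u = y⁻¹ * eval v * y
  · obtain ⟨y, rfl, hy⟩ := hg
    obtain ⟨w, rfl⟩ := exists_eval_eq y
    filter_upwards [eventually_ge_atTop w.length] with M hM x hx _
    exact ⟨w, hy, QuotientGroup.eq.1 hx, hM⟩
  · exact .of_forall fun M x hx hx' => absurd ⟨x, hx, hx'⟩ hg

theorem exists_conjBound_pow :
    ∃ C : ℕ, ∀ n : ℕ, ConjBound n (C * (n + 1) ^ 8) := by
  obtain ⟨C₀, h₀⟩ := exists_conjBound 2000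
  obtain ⟨C₁, h₁⟩ := exists_conjBound_step
  refine ⟨C₀ + 15 * (C₁ + 2), fun n => ?_⟩
  induction n using Nat.strong_induction_on with
  | _ n ih =>
    set A := C₀ + 15 * (C₁ + 2)
    rcases le_or_gt n 2000 with hn | hn
    · intro u v huv x hx
      refine (h₀ u v (huv.trans hn) x hx).mono ?_
      calc C₀ ≤ A := Nat.le_add_right _ _
        _ ≤ A * (n + 1) ^ 8 := Nat.le_mul_of_pos_right _ (by positivity)
    · obtain ⟨m, hm⟩ : ∃ m, m = (50 * n + 1300) / 61 := ⟨_, rfl⟩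
      -- For n > 2000 the additive constant 1300 = 2 · 650 is absorbed by weakening the ratio 50/61
      -- to 5/6.
      have hmn : 6 * (m + 1) ≤ 5 * (n + 1) := by omega
      intro u v huv x hx
      refine (h₁ m n _ (by omega) (ih m (by omega)) u v huv x hx).mono ?_
      have h₂ : 6 ^ 8 * (m + 1) ^ 8 ≤ 5 ^ 8 * (n + 1) ^ 8 := by
        rw [← mul_pow, ← mul_pow]
        exact Nat.pow_le_pow_left hmn 8
      have h₃ : n + 1 ≤ (n + 1) ^ 8 := Nat.le_self_pow (by norm_num) _
      -- 4 · (5/6)⁸ < 14/15, so one fifteenth of the bound is left for 2m + C₁.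
      have h₄ : 15 * (2 * m + C₁) ≤ A * (n + 1) ^ 8 := by
        calc 15 * (2 * m + C₁) ≤ A * (n + 1) := by
              have : m ≤ n := by omega
              have : 15 * (C₁ + 2) ≤ A := Nat.le_add_left _ _
              nlinarith
          _ ≤ _ := Nat.mul_le_mul_left _ h₃
      have h₅ := Nat.mul_le_mul_left A h₂
      norm_num at h₅
      nlinarith

end Grigorchuk

theorem mainTheorem4 :
    ∃ C : ℝ, ∀ u v : Grigorchuk.Word, Grigorchuk.IsReduced u → Grigorchuk.IsReduced v →
      0 < u.length + v.length →
      (∀ g ∈ Grigorchuk.Q (Grigorchuk.eval u) (Grigorchuk.eval v),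
        ∃ L : ℕ, IsLeast (Grigorchuk.conjugatorLengths u v g) L ∧
          (L : ℝ) ≤ C * ((u.length : ℝ) + (v.length : ℝ)) ^ 8) ∧
      (∃ h : ℕ, Grigorchuk.IsHeight u v h ∧
        (h : ℝ) ≤ Real.logb 1.22 ((u.length : ℝ) + (v.length : ℝ)) + C) := by
  obtain ⟨C, hC⟩ := Grigorchuk.exists_conjBound_pow
  refine ⟨max (C * 15 ^ 8) (Real.logb 1.22 154 + 5), fun u v hu hv huv => ⟨?_, ?_⟩⟩
  · rintro _ ⟨x, hx, rfl⟩
    obtain ⟨y, h₁, h₂, h₃⟩ := hC _ u v le_rfl x hx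
    have hmem : (Grigorchuk.red y).length ∈ Grigorchuk.conjugatorLengths u v x :=
      ⟨_, Grigorchuk.isReduced_red y, by rw [Grigorchuk.eval_red]; exact h₁,
        by rw [Grigorchuk.eval_red]; exact (QuotientGroup.eq.2 h₂).symm, rfl⟩
    refine ⟨_, ⟨Nat.sInf_mem ⟨_, hmem⟩, fun n hn => Nat.sInf_le hn⟩, ?_⟩
    have h₄ := (Nat.sInf_le hmem).trans (Grigorchuk.length_red_le y)
    -- Letters weigh at most 14, and the summand 1 is absorbed because the words are not both empty.
    have h₅ : Grigorchuk.weight u + Grigorchuk.weight v + 1 ≤ 15 * (u.length + v.length) := by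
      have := Grigorchuk.weight_le u
      have := Grigorchuk.weight_le v
      omega
    have h₆ := (h₄.trans h₃).trans (Nat.mul_le_mul_left C (Nat.pow_le_pow_left h₅ 8))
    rw [mul_pow, ← mul_assoc] at h₆
    calc ((sInf (Grigorchuk.conjugatorLengths u v x) : ℕ) : ℝ)
        ≤ C * 15 ^ 8 * ((u.length : ℝ) + v.length) ^ 8 := by exact_mod_cast h₆
      _ ≤ _ := mul_le_mul_of_nonneg_right (le_max_left _ _) (by positivity)
  · obtain ⟨n, hn, hle⟩ := Grigorchuk.exists_isHeight hu hv huv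
    exact ⟨n, hn, hle.trans (add_le_add_right (le_max_right _ _) _)⟩
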